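/- For a finite simple graph $G=(V,E)$, a set $S\subseteq V$ is dominating if every vertex of $V\setminus S$ has a neighbour in $S$, and the domination polynomial of $G$ is $D(G,x)=\sum_i d(G,i)x^i$, where $d(G,i)$ is the number of dominating sets of size $i$. For $n\ge 1$, the book graph $B_n$ is obtained from $n$ copies of the cycle $C_4$ by identifying one common edge. Let $\mathcal{L}_B$ be the set of limits of domination roots of the book graphs, i.e. the set of all $z\in\mathbb{C}$ such that either $D(B_n,z)=0$ for all sufficiently large $n$, or $z$ is a limit point (accumulation point) of $\bigcup_{n\ge 1}\{w\in\mathbb{C}: D(B_n,w)=0\}$. Theorem 5.1. We have $\mathcal{L}_B=\{0,-\tfrac12\}\cup C_{12}\cup C_{13}\cup C_{23}$, where $$C_{12}=\{x\in\mathbb{C}: |x(x+2)|=|x+1|^2\ge |x|\},$$ $$C_{13}=\{x\in\mathbb{C}: |x+2|=1,\ |x|\ge |x+1|^2\},$$ $$C_{23}=\{x\in\mathbb{C}: |x+1|^2=|x|,\ |x+2|\le 1\}.$$ Equivalently, in Cartesian coordinates $x=a+ib$: the set $C_{12}$ is the part of the hyperbola $(a+1)^2-b^2=\tfrac12$ for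 which $|x+1|^2\ge|x|$; the set $C_{13}$ is an arc of the circle $(a+2)^2+b^2=1$, namely its part with $|x|\ge|x+1|^2$; and the set $C_{23}$ is an arc of the quartic curve $\bigl((a+1)^2+b^2\bigr)^2=a^2+b^2$, namely its part in the closed disk $|x+2|\le 1$. Here an arc is the image of $[0,1]$ under an injective continuous map into $\mathbb{C}$. -/

import Mathlib

open Polynomial

/-- `S` is a dominating set of `G`: every vertex outside `S` has a neighbour in `S`. -/
def IsDominatingSet {V : Type*} (G : SimpleGraph V) (S : Finset V) : Prop :=
  ∀ v, v ∉ S → ∃ w ∈ S, G.Adj v w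

open Classical in
/-- `d(G, i)`: the number of dominating sets of `G` with exactly `i` vertices. -/
noncomputable def numDominatingSets {V : Type*} [Fintype V] (G : SimpleGraph V) (i : ℕ) : ℕ :=
  ((Finset.univ : Finset (Finset V)).filter
    fun S => S.card = i ∧ IsDominatingSet G S).card

/-- The domination polynomial `D(G, x) = ∑ d(G, i) xⁱ`. The terms with `i` below the domination
number vanish. -/
noncomputable def dominationPolynomial {V : Type*} [Fintype V] (G : SimpleGraph V) : ℤ[X] :=
  ∑ i ∈ Finset.range (Fintype.card V + 1), (numDominatingSets G i : ℤ[X]) * X ^ i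

/-- The book graph: `n` copies of the 4-cycle glued along one common edge (the spine).
The spine has the two ends `inl false` and `inl true`; the `i`-th copy contributes the two vertices
`inr (i, false)` and `inr (i, true)` and is the 4-cycle
`inl false, inl true, inr (i, true), inr (i, false)`. -/
def bookGraph (n : ℕ) : SimpleGraph (Bool ⊕ Fin n × Bool) where
  Adj
    | .inl a, .inl b => a ≠ b
    | .inl a, .inr p => a = p.2
    | .inr p, .inl b => p.2 = b
    | .inr p, .inr q => p.1 = q.1 ∧ p.2 ≠ q.2
  symm := ⟨by
    rintro (a | p) (b | q) h
    · exact Ne.symm h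
    · exact Eq.symm h
    · exact Eq.symm h
    · exact ⟨h.1.symm, h.2.symm⟩⟩
  loopless := ⟨by
    rintro (a | p) h
    · exact h rfl
    · exact h.2 rfl⟩

/-- `z` is a limit of roots of the sequence `f 1, f 2, f 3, …`: either `f n` vanishes at `z` for all
sufficiently large `n`, or `z` is a limit point (accumulation point) of the union of the sets of
complex roots of the `f n`, `n ≥ 1`. -/
def IsLimitOfRoots (f : ℕ → ℤ[X]) (z : ℂ) : Prop :=
  (∀ᶠ n in Filter.atTop, aeval z (f n) = 0) ∨
    AccPt z (Filter.principal {w : ℂ | ∃ n : ℕ, 1 ≤ n ∧ aeval w (f n) = 0})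

/-- The set of limits of domination roots of the book graphs. -/
def bookRootLimits : Set ℂ :=
  {z | IsLimitOfRoots (fun n => dominationPolynomial (bookGraph n)) z}

/-- `C₁₂ = {x : |x(x+2)| = |x+1|² ≥ |x|}`. -/
def bookC12 : Set ℂ := {x | ‖x * (x + 2)‖ = ‖x + 1‖ ^ 2 ∧ ‖x + 1‖ ^ 2 ≥ ‖x‖}

/-- `C₁₃ = {x : |x+2| = 1, |x| ≥ |x+1|²}`. -/
def bookC13 : Set ℂ := {x | ‖x + 2‖ = 1 ∧ ‖x‖ ≥ ‖x + 1‖ ^ 2}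

/-- `C₂₃ = {x : |x+1|² = |x|, |x+2| ≤ 1}`. -/
def bookC23 : Set ℂ := {x | ‖x + 1‖ ^ 2 = ‖x‖ ∧ ‖x + 2‖ ≤ 1}

/-- An arc in the complex plane: the image of `[0, 1]` under an injective continuous map. -/
def IsArc (S : Set ℂ) : Prop :=
  ∃ γ : unitInterval → ℂ, Continuous γ ∧ Function.Injective γ ∧ Set.range γ = S

/-! Sorting dominating sets by their trace on the spine gives, for n ≥ 1, the exponential sum D(B_n,
x) = x²((x+1)²)ⁿ + (2x+1)(x(x+2))ⁿ - 2xⁿ (`dominationPolynomial_bookGraph`). The limits of its zeros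
follow the Beraha–Kahane–Weiss pattern.

If one base is strictly largest in modulus at z and its coefficient is nonzero there, dividing by
its n-th power shows that no zeros lie near z for large n (`eventually_ne_zero_of_dominant`). If two
bases tie above the third, substituting z + u/n and passing to a subsequence gives a sum of two
exponentials in u as limit; Hurwitz's theorem carries its nonzero zeros back to zeros tending to z
(`accPt_of_norm_eq`). If the coefficient of the dominant base has a simple zero, Hurwitz applies
directly (`accPt_of_coeff_zero`); this happens at -1/2. The point 0 is a root for every n ≥ 1.

Points where all three moduli agree lie on C₁₃ and are limits of points of C₁₃ with a strict
inequality, so closedness of the derived set covers them. -/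

/-! ### The domination polynomial of the book graph -/

theorem dominationPolynomial_eq_sum {V : Type*} [Fintype V] (G : SimpleGraph V)
    [DecidablePred (IsDominatingSet G)] :
    dominationPolynomial G = ∑ S : Finset V, if IsDominatingSet G S then X ^ S.card else 0 := by
  classical
  have h : ∀ i, (numDominatingSets G i : ℤ[X]) * X ^ i =
      ∑ S : Finset V, if S.card = i ∧ IsDominatingSet G S then (X : ℤ[X]) ^ i else 0 := by
    intro i
    rw [← Finset.sum_filter, Finset.sum_const, nsmul_eq_mul, numDominatingSets]
    congr!
  unfold dominationPolynomial
  simp_rw [h]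
  rw [Finset.sum_comm]
  refine Finset.sum_congr rfl fun S _ => ?_
  rw [Finset.sum_eq_single S.card]
  · simp
  · intro i _ hi
    simp [hi.symm]
  · intro hS
    exact absurd (Finset.mem_range.2 (Nat.lt_succ_of_le S.card_le_univ)) hS

/-- Membership in the vertex set that is described by the two spine bits and the bits of the
pages. -/
def bookMem {n : ℕ} (c : Bool × Bool × (Fin n → Bool × Bool)) : Bool ⊕ Fin n × Bool → Bool
  | .inl false => c.1
  | .inl true => c.2.1
  | .inr (i, false) => (c.2.2 i).1
  | .inr (i, true) => (c.2.2 i).2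

/-- Vertex sets of the book graph, as spine bits and page bits. -/
def bookEquiv (n : ℕ) :
    (Bool × Bool × (Fin n → Bool × Bool)) ≃ Finset (Bool ⊕ Fin n × Bool) where
  toFun c := Finset.univ.filter fun v => bookMem c v = true
  invFun S := (decide (.inl false ∈ S), decide (.inl true ∈ S),
    fun i => (decide (.inr (i, false) ∈ S), decide (.inr (i, true) ∈ S)))
  left_inv := by
    rintro ⟨a, b, f⟩
    simp only [Finset.mem_filter, Finset.mem_univ, true_and, Bool.decide_eq_true]
    rfl
  right_inv := by
    intro S
    ext v
    rw [Finset.mem_filter]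
    rcases v with (_ | _) | ⟨i, (_ | _)⟩ <;> simp [bookMem]

theorem mem_bookEquiv {n : ℕ} (c : Bool × Bool × (Fin n → Bool × Bool))
    (v : Bool ⊕ Fin n × Bool) : v ∈ bookEquiv n c ↔ bookMem c v = true := by
  simp [bookEquiv]

theorem pow_card_bookEquiv {n : ℕ} {R : Type*} [CommSemiring R] (x : R) (a b : Bool)
    (f : Fin n → Bool × Bool) :
    x ^ (bookEquiv n (a, b, f)).card = (if a then x else 1) * (if b then x else 1) *
      ∏ i, ((if (f i).1 then x else 1) * (if (f i).2 then x else 1)) := by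
  have h : x ^ (bookEquiv n (a, b, f)).card =
      ∏ v, if bookMem (a, b, f) v = true then x else 1 := by
    rw [Finset.prod_ite, Finset.prod_const, Finset.prod_const_one, mul_one]
    rfl
  rw [h, Fintype.prod_sum_type, Fintype.prod_prod_type]
  simp only [Fintype.prod_bool, bookMem]
  exact congrArg₂ (· * ·) (mul_comm _ _) (Finset.prod_congr rfl fun i _ => mul_comm _ _)

theorem isDominatingSet_true_true {n : ℕ} (f : Fin n → Bool × Bool) :
    IsDominatingSet (bookGraph n) (bookEquiv n (true, true, f)) := by
  rintro ((_ | _) | ⟨i, (_ | _)⟩) hv <;>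
    simp_all [mem_bookEquiv, bookMem, bookGraph]

theorem isDominatingSet_true_false {n : ℕ} (f : Fin n → Bool × Bool) :
    IsDominatingSet (bookGraph n) (bookEquiv n (true, false, f)) ↔
      ∀ i, (f i).1 = true ∨ (f i).2 = true := by
  simp [IsDominatingSet, mem_bookEquiv, bookMem, bookGraph]
  grind

theorem isDominatingSet_false_true {n : ℕ} (f : Fin n → Bool × Bool) :
    IsDominatingSet (bookGraph n) (bookEquiv n (false, true, f)) ↔
      ∀ i, (f i).1 = true ∨ (f i).2 = true := by
  simp [IsDominatingSet, mem_bookEquiv, bookMem, bookGraph]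
  grind

/-- Without the spine, a page vertex can be dominated only by its partner on the page, and each
spine end needs a chosen page vertex on its own side. -/
theorem isDominatingSet_false_false {n : ℕ} (f : Fin n → Bool × Bool) :
    IsDominatingSet (bookGraph n) (bookEquiv n (false, false, f)) ↔
      (∀ i, (f i).1 = true ∨ (f i).2 = true) ∧ (∃ i, (f i).1 = true) ∧ ∃ i, (f i).2 = true := by
  simp [IsDominatingSet, mem_bookEquiv, bookMem, bookGraph]
  grind

/-- The sum over all page configurations that satisfy `P` on each page is a power. -/
theorem sum_prod_ite_forall {n : ℕ} {R : Type*} [CommSemiring R] (P : Bool × Bool → Prop)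
    [DecidablePred P] (w : Bool × Bool → R) :
    (∑ f : Fin n → Bool × Bool, if ∀ i, P (f i) then ∏ i, w (f i) else 0) =
      (∑ q, if P q then w q else 0) ^ n := by
  rw [← Fin.prod_const, Fintype.prod_sum]
  refine Finset.sum_congr rfl fun f _ => ?_
  exact (Finset.prod_ite_zero (s := Finset.univ) (p := fun i => P (f i))
    (f := fun i => w (f i))).symm ▸ by simp

/-- Both spine ends leave the pages free; one end requires every page to be hit, with weight x² + 2x
per page; no end requires the same, minus the two configurations that choose the same single side on
every page. For n = 0 these two coincide and the formula fails. -/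
theorem dominationPolynomial_bookGraph {n : ℕ} (hn : 1 ≤ n) :
    dominationPolynomial (bookGraph n) =
      X ^ 2 * ((X + 1) ^ 2) ^ n + (2 * X + 1) * (X * (X + 2)) ^ n + -2 * X ^ n := by
  classical
  rw [dominationPolynomial_eq_sum, ← (bookEquiv n).sum_comp]
  simp only [Fintype.sum_prod_type, Fintype.sum_bool, pow_card_bookEquiv,
    if_pos (isDominatingSet_true_true _), if_congr (isDominatingSet_true_false _) rfl rfl,
    if_congr (isDominatingSet_false_true _) rfl rfl,
    if_congr (isDominatingSet_false_false _) rfl rfl, if_true]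
  obtain ⟨w, hw⟩ : ∃ w : Bool × Bool → ℤ[X],
      w = fun q => (if q.1 then X else 1) * (if q.2 then X else 1) := ⟨_, rfl⟩
  have hW : ∀ f : Fin n → Bool × Bool, ∏ i, ((if (f i).1 then (X : ℤ[X]) else 1) *
    (if (f i).2 then X else 1)) = ∏ i, w (f i) := fun f => by rw [hw]
  simp only [hW]
  have h1 := sum_prod_ite_forall (n := n) (fun _ => True) w
  have h2 := sum_prod_ite_forall (n := n) (fun q => q.1 = true ∨ q.2 = true) w
  have h3 := sum_prod_ite_forall (n := n) (fun q => q = (true, false)) w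
  have h4 := sum_prod_ite_forall (n := n) (fun q => q = (false, true)) w
  have hsplit : ∀ f : Fin n → Bool × Bool,
      (if (∀ i, (f i).1 = true ∨ (f i).2 = true) ∧ (∃ i, (f i).1 = true) ∧ ∃ i, (f i).2 = true
        then ∏ i, w (f i) else 0) =
      (if ∀ i, (f i).1 = true ∨ (f i).2 = true then ∏ i, w (f i) else 0)
      - (if ∀ i, f i = (true, false) then ∏ i, w (f i) else 0)
      - (if ∀ i, f i = (false, true) then ∏ i, w (f i) else 0) := by
    intro f
    have i₀ : Fin n := ⟨0, hn⟩
    by_cases hA : ∀ i, (f i).1 = true ∨ (f i).2 = true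
    · by_cases h₁ : ∃ i, (f i).1 = true
      · have n₁ : ¬ ∀ i, f i = (false, true) := by
          rintro h; obtain ⟨i, hi⟩ := h₁; simp [h i] at hi
        by_cases h₂ : ∃ i, (f i).2 = true
        · have n₂ : ¬ ∀ i, f i = (true, false) := by
            rintro h; obtain ⟨i, hi⟩ := h₂; simp [h i] at hi
          rw [if_pos ⟨hA, h₁, h₂⟩, if_pos hA, if_neg n₁, if_neg n₂, sub_zero, sub_zero]
        · have n₂ : ∀ i, f i = (true, false) := fun i => by
            have := hA i
            have : ¬ (f i).2 = true := fun h => h₂ ⟨i, h⟩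
            ext <;> simp_all
          rw [if_neg (fun h => h₂ h.2.2), if_pos hA, if_neg n₁, if_pos n₂, sub_self, sub_zero]
      · have n₁ : ∀ i, f i = (false, true) := fun i => by
          have := hA i
          have : ¬ (f i).1 = true := fun h => h₁ ⟨i, h⟩
          ext <;> simp_all
        have n₂ : ¬ ∀ i, f i = (true, false) := fun h => h₁ ⟨i₀, by rw [h]⟩
        rw [if_neg (fun h => h₁ h.2.1), if_pos hA, if_pos n₁, if_neg n₂, sub_zero, sub_self]
    · have n₁ : ¬ ∀ i, f i = (true, false) := fun h => hA fun i => by simp [h i]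
      have n₂ : ¬ ∀ i, f i = (false, true) := fun h => hA fun i => by simp [h i]
      rw [if_neg (fun h => hA h.1), if_neg hA, if_neg n₁, if_neg n₂, sub_zero, sub_zero]
  simp only [Bool.false_eq_true, if_false, mul_one, one_mul, hsplit, Finset.sum_sub_distrib]
  have e1 : (∑ f : Fin n → Bool × Bool, ∏ i, w (f i)) = ((X + 1) ^ 2) ^ n := by
    rw [← Finset.sum_congr rfl fun f _ => if_pos (fun _ => trivial), h1]
    congr 1
    simp [Fintype.sum_prod_type, hw]
    ring
  have e2 : (∑ q, if q.1 = true ∨ q.2 = true then w q else 0) = X * (X + 2) := by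
    simp [Fintype.sum_prod_type, hw]
    ring
  have e3 : (∑ q, if q = (true, false) then w q else 0) = X := by simp [hw]
  have e4 : (∑ q, if q = (false, true) then w q else 0) = X := by simp [hw]
  rw [e2] at h2
  rw [e3] at h3
  rw [e4] at h4
  simp only [← mul_ite_zero, ← Finset.mul_sum, h2, h3, h4, e1]
  ring

/-! ### Zeros of three-term exponential sums near a point -/

open Filter Topology Metric

/-- A form of Hurwitz's theorem: zeros persist under joint convergence on a closed disc. -/
theorem eventually_exists_zero_of_tendsto {F : ℕ → ℂ → ℂ} {Φ : ℂ → ℂ} {u₀ : ℂ} {r : ℝ}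
    {l : Filter ℕ} (hr : 0 < r) (hF : ∀ n, DifferentiableOn ℂ (F n) (closedBall u₀ r))
    (hΦ : Continuous Φ)
    (hlim : ∀ u ∈ closedBall u₀ r, Tendsto (fun p : ℕ × ℂ => F p.1 p.2) (l ×ˢ 𝓝 u) (𝓝 (Φ u)))
    (hne : ∀ u ∈ sphere u₀ r, Φ u ≠ 0) (h0 : Φ u₀ = 0) :
    ∀ᶠ n in l, ∃ u ∈ closedBall u₀ r, F n u = 0 := by
  obtain ⟨v, hv, hmin⟩ := (isCompact_sphere u₀ r).exists_isMinOn
    (NormedSpace.sphere_nonempty.2 hr.le) hΦ.norm.continuousOn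
  have hm : 0 < ‖Φ v‖ := norm_pos_iff.2 (hne v hv)
  -- Compactness of the circle turns the pointwise joint limits into one lower bound valid on the
  -- whole circle for all large indices.
  have h1 : ∀ᶠ p : ℕ × ℂ in l ×ˢ 𝓝ˢ (sphere u₀ r), ‖Φ v‖ / 2 < ‖F p.1 p.2‖ := by
    refine (isCompact_sphere u₀ r).mem_prod_nhdsSet_of_forall fun u hu => ?_
    have : ‖Φ v‖ / 2 < ‖Φ u‖ := lt_of_lt_of_le (by linarith) (hmin hu)
    exact (hlim u (sphere_subset_closedBall hu)).norm.eventually_const_lt this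
  have h2 : ∀ᶠ n in l, ‖F n u₀‖ < ‖Φ v‖ / 2 := by
    have h := (hlim u₀ (mem_closedBall_self hr.le)).comp
      (tendsto_id.prodMk (tendsto_const_nhds (x := u₀) (f := l)))
    have h' := h.norm
    rw [h0, norm_zero] at h'
    exact h'.eventually_lt_const (half_pos hm)
  filter_upwards [h1.curry, h2] with n hn1 hn2
  by_contra! hcon
  -- Were `F n` zero-free, the maximum principle for its inverse would contradict the smallness of
  -- `F n u₀`.
  have hd : DiffContOnCl ℂ (fun u => (F n u)⁻¹) (ball u₀ r) :=
    DifferentiableOn.diffContOnCl_ball ((hF n).inv hcon) subset_rfl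
  have hb := Complex.norm_le_of_forall_mem_frontier_norm_le isBounded_ball hd
    (C := (‖Φ v‖ / 2)⁻¹) (fun u hu => by
      rw [frontier_ball _ hr.ne'] at hu
      rw [norm_inv]
      exact inv_anti₀ (half_pos hm) (hn1.self_of_nhdsSet u hu).le)
    (subset_closure (mem_ball_self hr))
  rw [norm_inv, inv_le_inv₀ (norm_pos_iff.2 (hcon _ (mem_closedBall_self hr.le)))
    (half_pos hm)] at hb
  linarith

theorem tendsto_rescale (z u : ℂ) :
    Tendsto (fun p : ℕ × ℂ => z + p.2 / p.1) (atTop ×ˢ 𝓝 u) (𝓝 z) := by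
  have h1 : Tendsto (fun p : ℕ × ℂ => p.2 * (p.1 : ℂ)⁻¹) (atTop ×ˢ 𝓝 u) (𝓝 (u * 0)) :=
    tendsto_snd.mul (tendsto_inv_atTop_nhds_zero_nat.comp tendsto_fst)
  simpa [div_eq_mul_inv] using h1.const_add z

/-- Apply n(L(z + u/n) - L(z)) → L'(z)u to L = log(p/p(z)); the normalisation keeps the argument
near 1, away from the branch cut. -/
theorem tendsto_rescale_pow {p : ℂ → ℂ} {a z : ℂ} (hp : HasDerivAt p a z) (hz : p z ≠ 0)
    (u : ℂ) :
    Tendsto (fun q : ℕ × ℂ => (p (z + q.2 / q.1) / p z) ^ q.1) (atTop ×ˢ 𝓝 u)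
      (𝓝 (Complex.exp (a / p z * u))) := by
  have hL : HasDerivAt (fun w => Complex.log (p w / p z)) (a / p z) z := by
    have h := (hp.div_const (p z)).clog (by simp [div_self hz])
    simpa [div_self hz] using h
  have hlim := hL.hasFDerivAt.hasFDerivWithinAt (s := Set.univ).lim
    (l := atTop ×ˢ 𝓝 u) (c := fun q : ℕ × ℂ => (q.1 : ℂ)) (d := fun q : ℕ × ℂ => q.2 / q.1) (v := u)
    (by simpa using (tendsto_rescale 0 u)) (by simp)
    (by
      refine tendsto_snd.congr' ?_
      filter_upwards [tendsto_fst.eventually (eventually_ge_atTop 1)] with q hq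
      have : (q.1 : ℂ) ≠ 0 := Nat.cast_ne_zero.2 (by omega)
      simp only [smul_eq_mul]
      field_simp)
  have hne : ∀ᶠ q : ℕ × ℂ in atTop ×ˢ 𝓝 u, p (z + q.2 / q.1) ≠ 0 :=
    (tendsto_rescale z u).eventually (hp.continuousAt.eventually_ne hz)
  have hexp := (Complex.continuous_exp.tendsto _).comp hlim
  simp only [ContinuousLinearMap.toSpanSingleton_apply, smul_eq_mul, div_self hz,
    Complex.log_one, sub_zero] at hexp
  rw [mul_comm u] at hexp
  refine hexp.congr' ?_
  filter_upwards [hne] with q hq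
  simp only [Function.comp]
  rw [Complex.exp_nat_mul, Complex.exp_log (div_ne_zero hq hz)]

theorem tendsto_pow_zero_of_tendsto {X : Type*} {l : Filter X} {f : X → ℂ} {k : X → ℕ} {c : ℂ}
    (hf : Tendsto f l (𝓝 c)) (hc : ‖c‖ < 1) (hk : Tendsto k l atTop) :
    Tendsto (fun x => f x ^ k x) l (𝓝 0) := by
  obtain ⟨q, hq1, hq2⟩ := exists_between hc
  have hq0 : 0 ≤ q := (norm_nonneg c).trans hq1.le
  refine squeeze_zero_norm' ?_ ((tendsto_pow_atTop_nhds_zero_of_lt_one hq0 hq2).comp hk)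
  filter_upwards [hf.norm.eventually_lt_const hq1] with x hx
  rw [norm_pow]
  exact pow_le_pow_left₀ (norm_nonneg _) hx.le _

/-- The zeros of `α pⁿ + β qⁿ + γ rⁿ`, `n ≥ 1`. -/
def expSumZeros (p q r α β γ : ℂ → ℂ) : Set ℂ :=
  {w | ∃ n : ℕ, 1 ≤ n ∧ α w * p w ^ n + β w * q w ^ n + γ w * r w ^ n = 0}

/-- Insisting on a nonzero logarithm (2πi when w = 1) is what later makes the zeros near z + u/n
differ from z. -/
theorem exists_exp_eq_ne_zero {w : ℂ} (hw : w ≠ 0) : ∃ v ≠ 0, Complex.exp v = w := by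
  by_cases h : Complex.log w = 0
  · refine ⟨2 * Real.pi * Complex.I, Complex.two_pi_I_ne_zero, ?_⟩
    rw [Complex.exp_two_pi_mul_I, ← Complex.exp_log hw, h, Complex.exp_zero]
  · exact ⟨_, h, Complex.exp_log hw⟩

/-- An exponential sum of two terms has a nonzero simple zero. -/
theorem exists_zero_exp_sum {A B a b : ℂ} (hA : A ≠ 0) (hB : B ≠ 0) (hab : a ≠ b) :
    ∃ u ≠ 0, A * Complex.exp (a * u) + B * Complex.exp (b * u) = 0 ∧
      ∀ᶠ v in 𝓝[≠] u, A * Complex.exp (a * v) + B * Complex.exp (b * v) ≠ 0 := by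
  obtain ⟨v, hv0, hv⟩ := exists_exp_eq_ne_zero (neg_ne_zero.2 (div_ne_zero hB hA))
  have hab' : a - b ≠ 0 := sub_ne_zero.2 hab
  have hz : A * Complex.exp (a * (v / (a - b))) + B * Complex.exp (b * (v / (a - b))) = 0 := by
    have : a * (v / (a - b)) = v + b * (v / (a - b)) := by field_simp; ring
    rw [this, Complex.exp_add, hv]
    field_simp
    ring
  refine ⟨v / (a - b), div_ne_zero hv0 hab', hz, ?_⟩
  set u := v / (a - b)
  have hd : HasDerivAt (fun v => A * Complex.exp (a * v) + B * Complex.exp (b * v))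
      (A * (Complex.exp (a * u) * (a * 1)) + B * (Complex.exp (b * u) * (b * 1))) u :=
    ((((hasDerivAt_id u).const_mul a).cexp).const_mul A).add
      ((((hasDerivAt_id u).const_mul b).cexp).const_mul B)
  refine hd.eventually_ne ?_
  -- The vanishing of the sum at u eliminates B, leaving a visibly nonzero derivative, so the zero
  -- is isolated.
  have : A * (Complex.exp (a * u) * (a * 1)) + B * (Complex.exp (b * u) * (b * 1)) =
      (a - b) * (A * Complex.exp (a * u)) := by
    linear_combination b * hz
  rw [this]
  exact mul_ne_zero hab' (mul_ne_zero hA (Complex.exp_ne_zero _))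

theorem exists_closedBall_ne {P : ℂ → Prop} {u : ℂ} {ε : ℝ} (hε : 0 < ε)
    (h : ∀ᶠ v in 𝓝[≠] u, P v) : ∃ r, 0 < r ∧ r < ε ∧ ∀ v ∈ closedBall u r, v ≠ u → P v := by
  rw [eventually_nhdsWithin_iff, eventually_nhds_iff_ball] at h
  obtain ⟨δ, hδ, hP⟩ := h
  refine ⟨min δ ε / 2, by positivity, ?_, fun v hv hvu => hP v ?_ hvu⟩
  · have := min_le_right δ ε; linarith
  · have := min_le_left δ ε
    have hv' := mem_closedBall.1 hv
    rw [mem_ball]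
    have : 0 < min δ ε := lt_min hδ hε
    linarith

/-- Two dominant terms of equal modulus: zeros accumulate. -/
theorem accPt_of_norm_eq {p q r α β γ : ℂ → ℂ} {z : ℂ}
    (hp : Differentiable ℂ p) (hq : Differentiable ℂ q) (hr : Differentiable ℂ r)
    (hα : Differentiable ℂ α) (hβ : Differentiable ℂ β) (hγ : Differentiable ℂ γ)
    (hpq : ‖p z‖ = ‖q z‖) (hrq : ‖r z‖ < ‖q z‖) (hα0 : α z ≠ 0) (hβ0 : β z ≠ 0)
    (hder : deriv p z * q z ≠ p z * deriv q z) :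
    AccPt z (𝓟 (expSumZeros p q r α β γ)) := by
  have hq0 : q z ≠ 0 := norm_pos_iff.1 ((norm_nonneg _).trans_lt hrq)
  have hp0 : p z ≠ 0 := norm_pos_iff.1 (hpq ▸ norm_pos_iff.2 hq0)
  have hnorm : ‖p z / q z‖ = 1 := by rw [norm_div, hpq, div_self (norm_ne_zero_iff.2 hq0)]
  -- The powers of the unimodular ratio need not converge; a subsequence does, and `l` is the filter
  -- along it.
  obtain ⟨ω, hω, φ, hφ, hφlim⟩ := (isCompact_sphere (0 : ℂ) 1).tendsto_subseq
    (x := fun n : ℕ => (p z / q z) ^ n) (fun n => by rw [mem_sphere_zero_iff_norm, norm_pow, hnorm, one_pow])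
  set l : Filter ℕ := map φ atTop with hl
  have hlat : l ≤ atTop := hφ.tendsto_atTop
  have hωlim : Tendsto (fun n : ℕ => (p z / q z) ^ n) l (𝓝 ω) := hφlim
  have hω0 : ω ≠ 0 := by
    rintro rfl
    simp at hω
  -- The hypothesis `hder` says that the logarithmic derivatives, which are the exponents in the
  -- limit, differ.
  have hab : deriv p z / p z ≠ deriv q z / q z := by
    intro h
    rw [div_eq_div_iff hp0 hq0] at h
    exact hder (h.trans (mul_comm _ _))
  obtain ⟨u₀, hu₀, hzero, hiso⟩ := exists_zero_exp_sum (mul_ne_zero hα0 hω0) hβ0 hab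
  obtain ⟨ρ, hρ, hρu, hne⟩ := exists_closedBall_ne (norm_pos_iff.2 hu₀) hiso
  have key := eventually_exists_zero_of_tendsto (l := l)
    (F := fun n u => (α (z + u / n) * p (z + u / n) ^ n + β (z + u / n) * q (z + u / n) ^ n +
      γ (z + u / n) * r (z + u / n) ^ n) / q z ^ n)
    (Φ := fun u => α z * ω * Complex.exp (deriv p z / p z * u) +
      β z * Complex.exp (deriv q z / q z * u)) hρ
    (fun n => Differentiable.differentiableOn (by fun_prop)) (by fun_prop)
    (fun u _ => by
      have hle : l ×ˢ 𝓝 u ≤ atTop ×ˢ 𝓝 u := prod_mono hlat le_rfl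
      have hres := (tendsto_rescale z u).mono_left hle
      have t1 := (tendsto_rescale_pow (hp z).hasDerivAt hp0 u).mono_left hle
      have t2 := (tendsto_rescale_pow (hq z).hasDerivAt hq0 u).mono_left hle
      have t3 : Tendsto (fun x : ℕ × ℂ => (r (z + x.2 / x.1) / q z) ^ x.1) (l ×ˢ 𝓝 u) (𝓝 0) :=
        tendsto_pow_zero_of_tendsto
          ((((hr z).continuousAt.tendsto.comp hres)).div_const (q z))
          (by rw [norm_div]; exact (div_lt_one (norm_pos_iff.2 hq0)).2 hrq)
          ((tendsto_id.mono_left hlat).comp tendsto_fst)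
      have tω : Tendsto (fun x : ℕ × ℂ => (p z / q z) ^ x.1) (l ×ˢ 𝓝 u) (𝓝 ω) :=
        hωlim.comp tendsto_fst
      have T := ((((hα z).continuousAt.tendsto.comp hres).mul tω).mul t1).add
        (((hβ z).continuousAt.tendsto.comp hres).mul t2) |>.add
        (((hγ z).continuousAt.tendsto.comp hres).mul t3)
      rw [mul_zero, add_zero] at T
      refine T.congr fun x => ?_
      simp only [Function.comp, div_pow]
      have := pow_ne_zero x.1 hp0
      have := pow_ne_zero x.1 hq0
      field_simp)
    (fun u hu => hne u (sphere_subset_closedBall hu) (ne_of_mem_sphere hu hρ.ne')) hzero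
  rw [accPt_iff_frequently, frequently_iff]
  intro U hU
  have hsmall : Tendsto (fun n : ℕ => (‖u₀‖ + ρ) / n) l (𝓝 0) :=
    (tendsto_const_div_atTop_nhds_zero_nat _).mono_left hlat
  obtain ⟨ε, hε, hεU⟩ := Metric.mem_nhds_iff.1 hU
  obtain ⟨n, ⟨u, hu, hun⟩, hn1, hnε⟩ := (key.and (((eventually_ge_atTop 1).filter_mono hlat).and
    (hsmall.eventually_lt_const hε))).exists
  have hn0 : (n : ℂ) ≠ 0 := Nat.cast_ne_zero.2 (by omega)
  -- The disc about `u₀` has radius below `‖u₀‖`, so it misses 0.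
  have hu0 : u ≠ 0 := by
    rintro rfl
    rw [mem_closedBall, dist_eq_norm, zero_sub, norm_neg] at hu
    linarith
  refine ⟨z + u / n, hεU ?_, ?_, n, hn1, ?_⟩
  · rw [mem_ball, dist_eq_norm, add_sub_cancel_left, norm_div, Complex.norm_natCast]
    refine lt_of_le_of_lt ?_ hnε
    gcongr
    have := norm_sub_norm_le u u₀
    rw [mem_closedBall, dist_eq_norm] at hu
    linarith
  · simp [hu0, hn0]
  · exact (div_eq_zero_iff.1 hun).resolve_right (pow_ne_zero n hq0)

/-- A single dominant term whose coefficient has a simple zero: zeros accumulate, provided that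
the point itself is not one of them. -/
theorem accPt_of_coeff_zero {p q r α β γ : ℂ → ℂ} {z : ℂ}
    (hp : Differentiable ℂ p) (hq : Differentiable ℂ q) (hr : Differentiable ℂ r)
    (hα : Differentiable ℂ α) (hβ : Differentiable ℂ β) (hγ : Differentiable ℂ γ)
    (hpq : ‖p z‖ < ‖q z‖) (hrq : ‖r z‖ < ‖q z‖) (hβ0 : β z = 0) (hder : deriv β z ≠ 0)
    (hz : z ∉ expSumZeros p q r α β γ) :
    AccPt z (𝓟 (expSumZeros p q r α β γ)) := by
  rw [accPt_iff_frequently, frequently_iff]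
  intro U hU
  obtain ⟨ε, hε, hεU⟩ := Metric.mem_nhds_iff.1 hU
  have hiso : ∀ᶠ v in 𝓝[≠] z, β v ≠ 0 := (hβ z).hasDerivAt.eventually_ne hder
  have hdom : ∀ᶠ v in 𝓝 z, ‖p v‖ < ‖q v‖ ∧ ‖r v‖ < ‖q v‖ :=
    (hp.continuous.norm.continuousAt.eventually_lt hq.continuous.norm.continuousAt hpq).and
      (hr.continuous.norm.continuousAt.eventually_lt hq.continuous.norm.continuousAt hrq)
  obtain ⟨ρ, hρ, hρε, hball⟩ := exists_closedBall_ne hε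
    (hiso.and (hdom.filter_mono nhdsWithin_le_nhds))
  have hdom' : ∀ v ∈ closedBall z ρ, ‖p v‖ < ‖q v‖ ∧ ‖r v‖ < ‖q v‖ := fun v hv => by
    by_cases h : v = z
    · rw [h]; exact ⟨hpq, hrq⟩
    · exact (hball v hv h).2
  have hq0 : ∀ v ∈ closedBall z ρ, q v ≠ 0 := fun v hv =>
    norm_pos_iff.1 ((norm_nonneg _).trans_lt (hdom' v hv).1)
  -- After division by the dominant power the limit is the coefficient `β` itself; no rescaling is
  -- needed.
  have key := eventually_exists_zero_of_tendsto (l := atTop)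
    (F := fun n v => (α v * p v ^ n + β v * q v ^ n + γ v * r v ^ n) / q v ^ n)
    (Φ := β) hρ
    (fun n => DifferentiableOn.div (Differentiable.differentiableOn (by fun_prop))
      (Differentiable.differentiableOn (by fun_prop)) fun v hv => pow_ne_zero n (hq0 v hv))
    hβ.continuous
    (fun v hv => by
      have hs : Tendsto (fun x : ℕ × ℂ => x.2) (atTop ×ˢ 𝓝 v) (𝓝 v) := tendsto_snd
      have hqv := hq.continuous.continuousAt.tendsto.comp hs
      have hsmall : ∀ f : ℂ → ℂ, Continuous f → ‖f v‖ < ‖q v‖ →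
          Tendsto (fun x : ℕ × ℂ => (f x.2 / q x.2) ^ x.1) (atTop ×ˢ 𝓝 v) (𝓝 0) := by
        intro f hf hlt
        exact tendsto_pow_zero_of_tendsto
          ((hf.continuousAt.tendsto.comp hs).div hqv (hq0 v hv))
          (by rw [norm_div]; exact (div_lt_one (norm_pos_iff.2 (hq0 v hv))).2 hlt) tendsto_fst
      have T := (((hα.continuous.continuousAt.tendsto.comp hs).mul
        (hsmall p hp.continuous (hdom' v hv).1)).add
        (hβ.continuous.continuousAt.tendsto.comp hs)).add
        ((hγ.continuous.continuousAt.tendsto.comp hs).mul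
          (hsmall r hr.continuous (hdom' v hv).2))
      rw [mul_zero, mul_zero, zero_add, add_zero] at T
      refine T.congr' ?_
      filter_upwards [hqv.eventually_ne (hq0 v hv)] with x hx
      simp only [Function.comp, div_pow] at hx ⊢
      have := pow_ne_zero x.1 hx
      field_simp)
    (fun u hu => (hball u (sphere_subset_closedBall hu) (ne_of_mem_sphere hu hρ.ne')).1) hβ0
  obtain ⟨n, ⟨v, hv, hvn⟩, hn1⟩ := (key.and (eventually_ge_atTop 1)).exists
  have hmem : v ∈ expSumZeros p q r α β γ :=
    ⟨n, hn1, (div_eq_zero_iff.1 hvn).resolve_right (pow_ne_zero n (hq0 v hv))⟩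
  refine ⟨v, hεU (mem_ball.2 ((mem_closedBall.1 hv).trans_lt hρε)), ?_, hmem⟩
  rintro rfl
  exact hz hmem

/-- A single dominant term with nonzero coefficient: for large `n` there are no zeros nearby. -/
theorem eventually_ne_zero_of_dominant {p q r α β γ : ℂ → ℂ} {z : ℂ}
    (hp : Continuous p) (hq : Continuous q) (hr : Continuous r)
    (hα : Continuous α) (hβ : Continuous β) (hγ : Continuous γ)
    (hpq : ‖p z‖ < ‖q z‖) (hrq : ‖r z‖ < ‖q z‖) (hβ0 : β z ≠ 0) :
    ∀ᶠ x : ℕ × ℂ in atTop ×ˢ 𝓝 z,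
      α x.2 * p x.2 ^ x.1 + β x.2 * q x.2 ^ x.1 + γ x.2 * r x.2 ^ x.1 ≠ 0 := by
  have hq0 : q z ≠ 0 := norm_pos_iff.1 ((norm_nonneg _).trans_lt hpq)
  have hs : Tendsto (fun x : ℕ × ℂ => x.2) (atTop ×ˢ 𝓝 z) (𝓝 z) := tendsto_snd
  have hqv := hq.continuousAt.tendsto.comp hs
  have hsmall : ∀ f : ℂ → ℂ, Continuous f → ‖f z‖ < ‖q z‖ →
      Tendsto (fun x : ℕ × ℂ => (f x.2 / q x.2) ^ x.1) (atTop ×ˢ 𝓝 z) (𝓝 0) := by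
    intro f hf hlt
    exact tendsto_pow_zero_of_tendsto ((hf.continuousAt.tendsto.comp hs).div hqv hq0)
      (by rw [norm_div]; exact (div_lt_one (norm_pos_iff.2 hq0)).2 hlt) tendsto_fst
  have T := (((hα.continuousAt.tendsto.comp hs).mul (hsmall p hp hpq)).add
    (hβ.continuousAt.tendsto.comp hs)).add
    ((hγ.continuousAt.tendsto.comp hs).mul (hsmall r hr hrq))
  rw [mul_zero, mul_zero, zero_add, add_zero] at T
  filter_upwards [hqv.eventually_ne hq0, T.eventually_ne hβ0] with x hx hT h0
  refine hT ?_
  simp only [Function.comp, div_pow] at hx ⊢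
  have := pow_ne_zero x.1 hx
  field_simp
  linear_combination h0

/-! ### The three curves in Cartesian coordinates -/

theorem Complex.norm_add_ofReal_sq (x : ℂ) (c : ℝ) :
    ‖x + c‖ ^ 2 = (x.re + c) ^ 2 + x.im ^ 2 := by
  rw [Complex.sq_norm, Complex.normSq_apply]
  simp
  ring

theorem norm_sq_eq_re_im (x : ℂ) : ‖x‖ ^ 2 = x.re ^ 2 + x.im ^ 2 := by
  simpa using Complex.norm_add_ofReal_sq x 0

theorem norm_add_one_sq (x : ℂ) : ‖x + 1‖ ^ 2 = (x.re + 1) ^ 2 + x.im ^ 2 := by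
  simpa using Complex.norm_add_ofReal_sq x 1

theorem norm_add_two_sq (x : ℂ) : ‖x + 2‖ ^ 2 = (x.re + 2) ^ 2 + x.im ^ 2 := by
  simpa using Complex.norm_add_ofReal_sq x 2

theorem norm_add_two_eq_one_iff (x : ℂ) : ‖x + 2‖ = 1 ↔ (x.re + 2) ^ 2 + x.im ^ 2 = 1 := by
  rw [← norm_add_two_sq, pow_eq_one_iff_of_nonneg (norm_nonneg _) two_ne_zero]

theorem norm_add_two_le_one_iff (x : ℂ) : ‖x + 2‖ ≤ 1 ↔ (x.re + 2) ^ 2 + x.im ^ 2 ≤ 1 := by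
  rw [← norm_add_two_sq, sq_le_one_iff₀ (norm_nonneg _)]

theorem norm_add_one_sq_eq_norm_iff (x : ℂ) :
    ‖x + 1‖ ^ 2 = ‖x‖ ↔ ((x.re + 1) ^ 2 + x.im ^ 2) ^ 2 = x.re ^ 2 + x.im ^ 2 := by
  rw [← norm_add_one_sq, ← norm_sq_eq_re_im, sq_eq_sq₀ (by positivity) (norm_nonneg _)]

theorem norm_add_one_sq_lt_norm_iff (x : ℂ) :
    ‖x + 1‖ ^ 2 < ‖x‖ ↔ ((x.re + 1) ^ 2 + x.im ^ 2) ^ 2 < x.re ^ 2 + x.im ^ 2 := by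
  rw [← norm_add_one_sq, ← norm_sq_eq_re_im, sq_lt_sq₀ (by positivity) (norm_nonneg _)]

theorem norm_add_one_sq_le_norm_iff (x : ℂ) :
    ‖x + 1‖ ^ 2 ≤ ‖x‖ ↔ ((x.re + 1) ^ 2 + x.im ^ 2) ^ 2 ≤ x.re ^ 2 + x.im ^ 2 := by
  rw [← norm_add_one_sq, ← norm_sq_eq_re_im, sq_le_sq₀ (by positivity) (norm_nonneg _)]

/-- With y = x + 1, |y² - 1|² = |y|⁴ - 2 Re y² + 1, so equality means Re y² = 1/2. -/
theorem norm_mul_add_two_eq_iff (x : ℂ) :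
    ‖x * (x + 2)‖ = ‖x + 1‖ ^ 2 ↔ (x.re + 1) ^ 2 - x.im ^ 2 = 1 / 2 := by
  rw [← sq_eq_sq₀ (norm_nonneg _) (by positivity), norm_mul, mul_pow, norm_add_one_sq,
    norm_add_two_sq, norm_sq_eq_re_im]
  constructor <;> intro h
  · linear_combination (-1 / 2) * h
  · linear_combination (-2) * h

theorem bookC12_eq :
    bookC12 = {x : ℂ | (x.re + 1) ^ 2 - x.im ^ 2 = 1 / 2 ∧ ‖x + 1‖ ^ 2 ≥ ‖x‖} := by
  ext x
  exact and_congr_left' (norm_mul_add_two_eq_iff x)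

theorem bookC13_eq :
    bookC13 = {x : ℂ | (x.re + 2) ^ 2 + x.im ^ 2 = 1 ∧ ‖x‖ ≥ ‖x + 1‖ ^ 2} := by
  ext x
  exact and_congr_left' (norm_add_two_eq_one_iff x)

theorem bookC23_eq :
    bookC23 = {x : ℂ | ((x.re + 1) ^ 2 + x.im ^ 2) ^ 2 = x.re ^ 2 + x.im ^ 2 ∧ ‖x + 2‖ ≤ 1} := by
  ext x
  exact and_congr_left' (norm_add_one_sq_eq_norm_iff x)

/-! ### Arc parametrisations -/

/-- A set that is symmetric about the real axis, crosses it at `s = 0`, and has its real part and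
the square of its imaginary part given by a parameter `s ∈ [0, 1]`, is an arc. -/
theorem isArc_of_re_im_sq {S : Set ℂ} {A B : ℝ → ℝ} (hA : Continuous A) (hB : Continuous B)
    (hinj : Set.InjOn A (Set.Icc 0 1)) (hpos : ∀ s ∈ Set.Icc (0 : ℝ) 1, 0 < B s)
    (hS : ∀ x : ℂ, x ∈ S ↔ ∃ s ∈ Set.Icc (0 : ℝ) 1, x.re = A s ∧ x.im ^ 2 = s * B s) :
    IsArc S := by
  have hsq : ∀ t : unitInterval, (2 * (t : ℝ) - 1) ^ 2 ∈ Set.Icc (0 : ℝ) 1 := fun t =>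
    ⟨sq_nonneg _, by nlinarith [t.2.1, t.2.2]⟩
  -- With v = 2t - 1 in [-1, 1] and s = v², the real part determines s, and the imaginary part then
  -- determines v because B > 0.
  refine ⟨fun t => ⟨A ((2 * (t : ℝ) - 1) ^ 2),
    (2 * (t : ℝ) - 1) * √(B ((2 * (t : ℝ) - 1) ^ 2))⟩, ?_, ?_, ?_⟩
  · have : Continuous fun t : unitInterval => Complex.equivRealProdCLM.symm
      (A ((2 * (t : ℝ) - 1) ^ 2), (2 * (t : ℝ) - 1) * √(B ((2 * (t : ℝ) - 1) ^ 2))) :=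
      Complex.equivRealProdCLM.symm.continuous.comp (by fun_prop)
    exact this
  · intro t₁ t₂ h
    obtain ⟨hre, him⟩ := Complex.ext_iff.1 h
    have hs := hinj (hsq t₁) (hsq t₂) hre
    simp only at him
    rw [hs] at him
    have := mul_right_cancel₀ (Real.sqrt_pos.2 (hpos _ (hsq t₂))).ne' him
    exact Subtype.ext (by linarith)
  · ext x
    rw [hS]
    constructor
    · rintro ⟨t, rfl⟩
      refine ⟨_, hsq t, rfl, ?_⟩
      simp only
      rw [mul_pow, Real.sq_sqrt (hpos _ (hsq t)).le]
    · rintro ⟨s, hs, hre, him⟩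
      have hBs := hpos s hs
      have hsqrt := Real.sqrt_pos.2 hBs
      set v := x.im / √(B s) with hv
      have hv2 : v ^ 2 = s := by
        rw [hv, div_pow, Real.sq_sqrt hBs.le, him]
        field_simp
      have hv1 : |v| ≤ 1 := by
        rw [← sq_le_one_iff_abs_le_one, hv2]
        exact hs.2
      obtain ⟨h1, h2⟩ := abs_le.1 hv1
      refine ⟨⟨(v + 1) / 2, by constructor <;> linarith⟩, ?_⟩
      have h3 : 2 * ((v + 1) / 2) - 1 = v := by ring
      apply Complex.ext
      · simp only [h3, hv2, hre]
      · simp only [h3, hv2]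
        exact div_mul_cancel₀ _ hsqrt.ne'

/-- On the circle put m = -1 - Re x. Then |x+1|² = 2m and |x|² = 4m + 1, so the inequality reads 4m²
≤ 4m + 1, that is m ≤ k = (1+√2)/2; the parameter is s = m/k. -/
theorem mem_bookC13_iff (x : ℂ) : x ∈ bookC13 ↔ ∃ s ∈ Set.Icc (0 : ℝ) 1,
    x.re = -1 - (1 + √2) / 2 * s ∧
      x.im ^ 2 = s * ((1 + √2) / 2 * (2 - (1 + √2) / 2 * s)) := by
  have h2 : √2 ^ 2 = 2 := Real.sq_sqrt zero_le_two
  have h0 : 0 ≤ √2 := Real.sqrt_nonneg 2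
  rw [bookC13_eq, Set.mem_ofPred_eq, ge_iff_le, norm_add_one_sq_le_norm_iff]
  set k := (1 + √2) / 2 with hk
  have hkk : 4 * k ^ 2 = 4 * k + 1 := by rw [hk]; linear_combination h2
  have hk1 : 0 < k := by positivity
  have hk12 : 1 < k := by
    have : 1 < √2 := Real.lt_sqrt_of_sq_lt (by norm_num)
    linarith
  constructor
  · rintro ⟨h, hle⟩
    have e1 : (x.re + 1) ^ 2 + x.im ^ 2 = -2 * x.re - 2 := by linear_combination h
    have e2 : x.re ^ 2 + x.im ^ 2 = -4 * x.re - 3 := by linear_combination h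
    rw [e1, e2] at hle
    have hm0 : 0 ≤ -1 - x.re := by nlinarith [sq_nonneg x.im, sq_nonneg (x.re + 1)]
    have hm1 : -1 - x.re ≤ k := by
      by_contra! hgt
      -- Uses 4m² - 4m - 1 = 4(m - k)(m + k - 1).
      linarith [mul_pos (sub_pos.2 hgt) (show 0 < -1 - x.re + k - 1 by linarith)]
    refine ⟨(-1 - x.re) / k, ⟨by positivity, (div_le_one hk1).2 hm1⟩, ?_, ?_⟩
    · field_simp
      ring
    · field_simp
      linear_combination h
  · rintro ⟨s, ⟨hs0, hs1⟩, hre, him⟩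
    have h : (x.re + 2) ^ 2 + x.im ^ 2 = 1 := by rw [him, hre]; ring
    refine ⟨h, ?_⟩
    have e1 : (x.re + 1) ^ 2 + x.im ^ 2 = -2 * x.re - 2 := by linear_combination h
    have e2 : x.re ^ 2 + x.im ^ 2 = -4 * x.re - 3 := by linear_combination h
    rw [e1, e2, hre]
    have : k * s ≤ k := by nlinarith
    have : 0 ≤ k * s := by positivity
    linarith [mul_nonneg (show 0 ≤ k - k * s by linarith) (show 0 ≤ k * s + k - 1 by linarith)]

theorem isArc_bookC13 : IsArc bookC13 := by
  have h2 : √2 ^ 2 = 2 := Real.sq_sqrt zero_le_two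
  have h0 : 0 ≤ √2 := Real.sqrt_nonneg 2
  refine isArc_of_re_im_sq (by fun_prop) (by fun_prop) ?_ ?_ mem_bookC13_iff
  · intro s _ t _ h
    simp only at h
    have hk : (1 + √2) / 2 ≠ 0 := by positivity
    exact mul_left_cancel₀ hk (by linarith)
  · rintro s ⟨hs0, hs1⟩
    have : √2 ≤ 2 := by nlinarith
    have : 0 < 2 - (1 + √2) / 2 * s := by nlinarith
    positivity

/-- The parameter is σ = |x+1|² = |x|; subtracting the squared moduli gives Re x. Nonnegativity of
(Im x)² gives the upper bound on σ, and |x+2|² = 2σ + 2 - σ² ≤ 1 gives the lower one. -/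
theorem mem_bookC23_iff (x : ℂ) : x ∈ bookC23 ↔ ∃ σ ∈ Set.Icc (1 + √2) ((3 + √5) / 2),
    x.re = (σ - 1 - σ ^ 2) / 2 ∧
      x.im ^ 2 = ((3 + √5) / 2 - σ) * (σ - (3 - √5) / 2) * (σ ^ 2 + σ + 1) / 4 := by
  have h2 : √2 ^ 2 = 2 := Real.sq_sqrt zero_le_two
  have h0 : 0 ≤ √2 := Real.sqrt_nonneg 2
  have h5 : √5 ^ 2 = 5 := Real.sq_sqrt (by norm_num)
  have h50 : 2 ≤ √5 := Real.le_sqrt_of_sq_le (by norm_num)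
  have hprod : ∀ σ : ℝ, ((3 + √5) / 2 - σ) * (σ - (3 - √5) / 2) = 3 * σ - σ ^ 2 - 1 := fun σ => by
    linear_combination h5 / 4
  rw [bookC23_eq, Set.mem_ofPred_eq, norm_add_two_le_one_iff]
  simp only [hprod]
  constructor
  · rintro ⟨h, hle⟩
    obtain ⟨σ, hσ⟩ : ∃ σ, σ = (x.re + 1) ^ 2 + x.im ^ 2 := ⟨_, rfl⟩
    have hσ0 : 0 ≤ σ := by rw [hσ]; positivity
    rw [← hσ] at h
    have hre : x.re = (σ - 1 - σ ^ 2) / 2 := by linear_combination (1 / 2) * h - (1 / 2) * hσ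
    have him : x.im ^ 2 = (3 * σ - σ ^ 2 - 1) * (σ ^ 2 + σ + 1) / 4 := by
      have : x.im ^ 2 = σ - (x.re + 1) ^ 2 := by linear_combination -hσ
      rw [this, hre]
      ring
    refine ⟨σ, ⟨?_, ?_⟩, hre, him⟩
    · have hsq : 0 ≤ σ ^ 2 - 2 * σ - 1 := by linarith
      by_contra! hlt
      have h1 : 1 < √2 := Real.lt_sqrt_of_sq_lt (by norm_num)
      linarith [mul_neg_of_neg_of_pos (show σ - 1 - √2 < 0 by linarith)
        (show 0 < σ - 1 + √2 by linarith)]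
    · have : 0 ≤ 3 * σ - σ ^ 2 - 1 := by
        by_contra! hneg
        have := mul_neg_of_neg_of_pos hneg (by positivity : 0 < σ ^ 2 + σ + 1)
        linarith [sq_nonneg x.im]
      rw [← hprod] at this
      by_contra! hgt
      exact this.not_gt (mul_neg_of_neg_of_pos (by linarith) (by linarith))
  · rintro ⟨σ, ⟨hl, hu⟩, hre, him⟩
    have hσ : (x.re + 1) ^ 2 + x.im ^ 2 = σ := by rw [him, hre]; ring
    refine ⟨?_, ?_⟩
    · rw [hσ]
      linear_combination 2 * hre - hσ
    · have : (x.re + 2) ^ 2 + x.im ^ 2 = σ + 2 * x.re + 3 := by linear_combination hσ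
      have := mul_nonneg (sub_nonneg.2 hl) (show 0 ≤ σ - 1 + √2 by linarith)
      linarith

theorem isArc_bookC23 : IsArc bookC23 := by
  have h2 : √2 ^ 2 = 2 := Real.sq_sqrt zero_le_two
  have h0 : 0 ≤ √2 := Real.sqrt_nonneg 2
  have h5 : √5 ^ 2 = 5 := Real.sq_sqrt (by norm_num)
  have h50 : 2.2 < √5 := Real.lt_sqrt_of_sq_lt (by norm_num)
  -- The length of the σ-interval; s = 0 is its upper end, where the curve meets the real axis.
  set d := (1 + √5) / 2 - √2 with hd
  have hd0 : 0 < d := by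
    have : √2 < 1.5 := by nlinarith
    rw [hd]; linarith
  have hσ : ∀ s ∈ Set.Icc (0 : ℝ) 1,
      (3 + √5) / 2 - d * s ∈ Set.Icc (1 + √2) ((3 + √5) / 2) := fun s hs => by
    have : d * s ≤ d := by nlinarith [hs.2]
    have : 0 ≤ d * s := mul_nonneg hd0.le hs.1
    constructor <;> linarith
  refine isArc_of_re_im_sq
    (A := fun s => ((3 + √5) / 2 - d * s - 1 - ((3 + √5) / 2 - d * s) ^ 2) / 2)
    (B := fun s => d * ((3 + √5) / 2 - d * s - (3 - √5) / 2) *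
      (((3 + √5) / 2 - d * s) ^ 2 + ((3 + √5) / 2 - d * s) + 1) / 4)
    (by fun_prop) (by fun_prop) ?_ ?_ ?_
  · intro s hs t ht h
    have h1 := (hσ s hs).1
    have h3 := (hσ t ht).1
    simp only at h
    have : (d * (t - s)) * (1 - (((3 + √5) / 2 - d * s) + ((3 + √5) / 2 - d * t))) = 0 := by
      linear_combination 2 * h
    rcases mul_eq_zero.1 this with h4 | h4
    · have := (mul_eq_zero.1 h4).resolve_left hd0.ne'
      linarith
    · linarith
  · intro s hs
    have h1 := (hσ s hs).1
    have : 0 < (3 + √5) / 2 - d * s - (3 - √5) / 2 := by linarith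
    have : 0 < (3 + √5) / 2 - d * s := by linarith
    positivity
  · intro x
    rw [mem_bookC23_iff]
    constructor
    · rintro ⟨σ, ⟨hl, hu⟩, hre, him⟩
      have e : (3 + √5) / 2 - d * (((3 + √5) / 2 - σ) / d) = σ := by field_simp; ring
      refine ⟨((3 + √5) / 2 - σ) / d, ⟨div_nonneg (by linarith) hd0.le,
        (div_le_one hd0).2 (by linarith)⟩, ?_, ?_⟩
      · rw [e, hre]
      · rw [e, him]
        field_simp
    · rintro ⟨s, hs, hre, him⟩
      refine ⟨_, hσ s hs, hre, ?_⟩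
      rw [him]
      ring

/-- The points of the circular arc where the remaining term is strictly smaller are dense. -/
theorem bookC13_subset_closure :
    bookC13 ⊆ closure {x : ℂ | ‖x + 2‖ = 1 ∧ ‖x + 1‖ ^ 2 < ‖x‖} := by
  have h2 : √2 ^ 2 = 2 := Real.sq_sqrt zero_le_two
  have h0 : 0 ≤ √2 := Real.sqrt_nonneg 2
  intro x hx
  obtain ⟨s, ⟨hs0, hs1⟩, hre, him⟩ := (mem_bookC13_iff x).1 hx
  set k := (1 + √2) / 2 with hk
  have hkk : 4 * k ^ 2 = 4 * k + 1 := by rw [hk]; linear_combination h2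
  have hk1 : 0 < k := by positivity
  have hk2 : k < 2 := by nlinarith
  have hk12 : 1 < k := by
    have : 1 < √2 := Real.lt_sqrt_of_sq_lt (by norm_num)
    linarith
  -- The sign e selects the upper or lower half of the arc; t < 1 makes the inequality strict.
  have hmem : ∀ e : ℝ, e ^ 2 = 1 → ∀ t ∈ Set.Ico (0 : ℝ) 1,
      (⟨-1 - k * t, e * √(t * (k * (2 - k * t)))⟩ : ℂ) ∈
        {x : ℂ | ‖x + 2‖ = 1 ∧ ‖x + 1‖ ^ 2 < ‖x‖} := by
    rintro e he t ⟨ht0, ht1⟩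
    have hkt : k * t < k := by nlinarith
    have hkt0 : 0 ≤ k * t := by positivity
    have hnn : 0 ≤ t * (k * (2 - k * t)) :=
      mul_nonneg ht0 (mul_nonneg hk1.le (by linarith))
    have hsq : (e * √(t * (k * (2 - k * t)))) ^ 2 = t * (k * (2 - k * t)) := by
      rw [mul_pow, he, one_mul, Real.sq_sqrt hnn]
    rw [Set.mem_ofPred_eq, norm_add_two_eq_one_iff, norm_add_one_sq_lt_norm_iff]
    simp only [hsq]
    constructor
    · ring
    · linarith [mul_pos (sub_pos.2 hkt) (show 0 < k * t + k - 1 by linarith)]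
  have hcl : ∀ e : ℝ, e ^ 2 = 1 →
      (⟨-1 - k * s, e * √(s * (k * (2 - k * s)))⟩ : ℂ) ∈
        closure {x : ℂ | ‖x + 2‖ = 1 ∧ ‖x + 1‖ ^ 2 < ‖x‖} := by
    intro e he
    have hcont : Continuous fun t : ℝ => (⟨-1 - k * t, e * √(t * (k * (2 - k * t)))⟩ : ℂ) := by
      have : Continuous fun t : ℝ => Complex.equivRealProdCLM.symm
        (-1 - k * t, e * √(t * (k * (2 - k * t)))) :=
        Complex.equivRealProdCLM.symm.continuous.comp (by fun_prop)
      exact this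
    have hs : s ∈ closure (Set.Ico (0 : ℝ) 1) := by
      rw [closure_Ico zero_ne_one]
      exact ⟨hs0, hs1⟩
    refine closure_mono ?_ (image_closure_subset_closure_image hcont ⟨s, hs, rfl⟩)
    rintro _ ⟨t, ht, rfl⟩
    exact hmem e he t ht
  rw [← him, Real.sqrt_sq_eq_abs, ← hre] at hcl
  rcases abs_choice x.im with h | h
  · simpa [h] using hcl 1 (by norm_num)
  · simpa [h] using hcl (-1) (by norm_num)

/-! ### Limits of the domination roots -/

/-- The complex numbers that are domination roots of a book graph. -/
abbrev bookRoots : Set ℂ :=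
  expSumZeros (fun x => (x + 1) ^ 2) (fun x => x * (x + 2)) (fun x => x)
    (fun x => x ^ 2) (fun x => 2 * x + 1) (fun _ => -2)

/-- The accumulation criterion expects the two tied bases first; the swaps bring any pair there. -/
theorem expSumZeros_swap_right (p q r α β γ : ℂ → ℂ) :
    expSumZeros p r q α γ β = expSumZeros p q r α β γ := by
  ext w
  simp only [expSumZeros, Set.mem_ofPred_eq, add_right_comm]

theorem expSumZeros_swap_left (p q r α β γ : ℂ → ℂ) :
    expSumZeros q p r β α γ = expSumZeros p q r α β γ := by
  ext w
  simp only [expSumZeros, Set.mem_ofPred_eq, add_comm (β w * _)]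

theorem aeval_dominationPolynomial_bookGraph {n : ℕ} (hn : 1 ≤ n) (w : ℂ) :
    aeval w (dominationPolynomial (bookGraph n)) =
      w ^ 2 * ((w + 1) ^ 2) ^ n + (2 * w + 1) * (w * (w + 2)) ^ n + -2 * w ^ n := by
  simp [dominationPolynomial_bookGraph hn, map_ofNat (aeval w) 2]

theorem dominationPolynomial_bookGraph_ne_zero {n : ℕ} (hn : 1 ≤ n) :
    dominationPolynomial (bookGraph n) ≠ 0 := by
  intro h
  have h1 := congrArg (eval 1) (dominationPolynomial_bookGraph hn)
  simp [h] at h1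
  have h3 : (1 : ℤ) ≤ 3 ^ n := one_le_pow₀ (by norm_num)
  have h4 : (1 : ℤ) ≤ 4 ^ n := one_le_pow₀ (by norm_num)
  linarith

theorem setOf_dominationRoots_bookGraph :
    {w : ℂ | ∃ n : ℕ, 1 ≤ n ∧ aeval w (dominationPolynomial (bookGraph n)) = 0} = bookRoots := by
  ext w
  refine exists_congr fun n => and_congr_right fun hn => ?_
  rw [aeval_dominationPolynomial_bookGraph hn]

/-- A point near which the polynomials eventually have no zeros is not a limit of roots. -/
theorem not_isLimitOfRoots {f : ℕ → ℤ[X]} (hf : ∀ n, 1 ≤ n → f n ≠ 0) {z : ℂ}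
    (h : ∀ᶠ x : ℕ × ℂ in atTop ×ˢ 𝓝 z, aeval x.2 (f x.1) ≠ 0) : ¬ IsLimitOfRoots f z := by
  rintro (h0 | hacc)
  · obtain ⟨n, hn, hn'⟩ := (h.curry.and h0).exists
    exact hn.self_of_nhds hn'
  · obtain ⟨P, hP, Q, hQ, hPQ⟩ := eventually_prod_iff.1 h
    obtain ⟨N, hN⟩ := eventually_atTop.1 hP
    -- The finitely many early polynomials are nonzero, so a punctured neighbourhood avoids all
    -- their roots.
    have hsmall : ∀ᶠ w in 𝓝[≠] z, ∀ n ∈ Finset.Icc 1 N, aeval w (f n) ≠ 0 := by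
      rw [eventually_all_finset]
      intro n hn
      have hn0 := hf n (Finset.mem_Icc.1 hn).1
      have : ∀ᶠ w in cofinite, w ∉ (f n).rootSet ℂ :=
        (rootSet_finite (f n) ℂ).compl_mem_cofinite
      filter_upwards [nhdsNE_le_cofinite z this] with w hw hw0
      exact hw ((mem_rootSet_of_ne hn0).2 hw0)
    rw [accPt_iff_frequently_nhdsNE] at hacc
    obtain ⟨w, ⟨n, hn, hw0⟩, hws, hwQ⟩ :=
      (hacc.and_eventually (hsmall.and (hQ.filter_mono nhdsWithin_le_nhds))).exists
    by_cases hnN : n ≤ N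
    · exact hws n (Finset.mem_Icc.2 ⟨hn, hnN⟩) hw0
    · exact hPQ (hN n (le_of_not_ge hnN)) hwQ hw0

theorem isLimitOfRoots_of_accPt {z : ℂ} (h : AccPt z (𝓟 bookRoots)) : z ∈ bookRootLimits := by
  right
  rw [setOf_dominationRoots_bookGraph]
  exact h

/-- The dominant coefficient x² has a double zero at 0 and 0 is itself a root, so this point enters
through the first alternative of the definition. -/
theorem zero_mem_bookRootLimits : (0 : ℂ) ∈ bookRootLimits := by
  left
  filter_upwards [eventually_ge_atTop 1] with n hn
  rw [aeval_dominationPolynomial_bookGraph hn]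
  simp [show n ≠ 0 by omega]

theorem hasDerivAt_add_one_sq (z : ℂ) :
    HasDerivAt (fun x : ℂ => (x + 1) ^ 2) (2 * (z + 1)) z := by
  simpa using ((hasDerivAt_id z).add_const 1).fun_pow 2

theorem hasDerivAt_mul_add_two (z : ℂ) :
    HasDerivAt (fun x : ℂ => x * (x + 2)) (2 * z + 2) z := by
  refine ((hasDerivAt_id z).mul ((hasDerivAt_id z).add_const 2)).congr_deriv ?_
  simp
  ring

theorem neg_half_notMem_bookRoots : (-1 / 2 : ℂ) ∉ bookRoots := by
  rintro ⟨n, hn, h⟩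
  norm_num at h
  have h' : (1 / 4 : ℂ) * (1 / 4) ^ n = 2 * (-1 / 2) ^ n := by linear_combination h
  have h'' := congrArg norm h'
  simp only [norm_mul, norm_pow, norm_div, norm_neg, norm_one, Complex.norm_ofNat] at h''
  have : (1 / 4 : ℝ) ^ n ≤ (1 / 2) ^ n := pow_le_pow_left₀ (by norm_num) (by norm_num) n
  have : 0 < (1 / 2 : ℝ) ^ n := by positivity
  linarith

/-- At -1/2 the bases have moduli 1/4, 3/4 and 1/2, and the coefficient 2x + 1 of the dominant one
has a simple zero. -/
theorem accPt_neg_half : AccPt (-1 / 2 : ℂ) (𝓟 bookRoots) := by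
  refine accPt_of_coeff_zero (by fun_prop) (by fun_prop) (by fun_prop) (by fun_prop)
    (by fun_prop) (by fun_prop) ?_ ?_ (by norm_num) ?_ neg_half_notMem_bookRoots
  · norm_num
  · norm_num
  · have : HasDerivAt (fun x : ℂ => 2 * x + 1) (2 * 1) (-1 / 2) :=
      ((hasDerivAt_id _).const_mul 2).add_const 1
    rw [this.deriv]
    norm_num

theorem accPt_of_mem_C12_strict {z : ℂ} (h : ‖z * (z + 2)‖ = ‖z + 1‖ ^ 2)
    (hlt : ‖z‖ < ‖z + 1‖ ^ 2) : AccPt z (𝓟 bookRoots) := by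
  have hz1 : z + 1 ≠ 0 := by
    intro h0
    rw [h0] at hlt
    simp at hlt
    linarith [norm_nonneg z]
  refine accPt_of_norm_eq (by fun_prop) (by fun_prop) (by fun_prop) (by fun_prop)
    (by fun_prop) (by fun_prop) ?_ ?_ ?_ ?_ ?_
  · rw [h, norm_pow]
  · rwa [h]
  · refine pow_ne_zero 2 ?_
    rintro rfl
    simp at h
  · intro h0
    have : z = -1 / 2 := by linear_combination h0 / 2
    subst this
    norm_num at h
  · rw [(hasDerivAt_add_one_sq z).deriv, (hasDerivAt_mul_add_two z).deriv]
    intro h0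
    exact hz1 (by linear_combination (-1 / 2) * h0)

theorem accPt_of_mem_C13_strict {z : ℂ} (h : ‖z + 2‖ = 1)
    (hlt : ‖z + 1‖ ^ 2 < ‖z‖) : AccPt z (𝓟 bookRoots) := by
  have hz0 : z ≠ 0 := by
    rintro rfl
    norm_num at h
  rw [bookRoots, ← expSumZeros_swap_left, ← expSumZeros_swap_right]
  refine accPt_of_norm_eq (by fun_prop) (by fun_prop) (by fun_prop) (by fun_prop)
    (by fun_prop) (by fun_prop) ?_ ?_ ?_ ?_ ?_
  · rw [norm_mul, h, mul_one]
  · rwa [norm_pow]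
  · intro h0
    have : z = -1 / 2 := by linear_combination h0 / 2
    subst this
    norm_num at h
  · norm_num
  · rw [deriv_id'', (hasDerivAt_mul_add_two z).deriv]
    intro h0
    exact pow_ne_zero 2 hz0 (by linear_combination h0)

theorem accPt_of_mem_C23_strict {z : ℂ} (h : ‖z + 1‖ ^ 2 = ‖z‖)
    (hlt : ‖z + 2‖ < 1) : AccPt z (𝓟 bookRoots) := by
  have hz0 : z ≠ 0 := by
    rintro rfl
    norm_num at h
  have hz1 : z + 1 ≠ 0 := by
    intro h0
    rw [h0] at h
    simp at h
    exact hz0 (norm_eq_zero.1 h.symm)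
  rw [bookRoots, ← expSumZeros_swap_right]
  refine accPt_of_norm_eq (by fun_prop) (by fun_prop) (by fun_prop) (by fun_prop)
    (by fun_prop) (by fun_prop) ?_ ?_ (pow_ne_zero 2 hz0) (by norm_num) ?_
  · rw [norm_pow, h]
  · rw [norm_mul]
    exact mul_lt_of_lt_one_right (norm_pos_iff.2 hz0) hlt
  · rw [deriv_id'', (hasDerivAt_add_one_sq z).deriv]
    intro h0
    have h1 : (z + 1) * (z - 1) = 0 := by linear_combination h0
    have : z = 1 := sub_eq_zero.1 ((mul_eq_zero.1 h1).resolve_left hz1)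
    subst this
    norm_num at hlt

/-- Where all three moduli agree the two-term criterion fails; density of the strict points and
closedness of the derived set replace it. -/
theorem accPt_of_mem_bookC13 {z : ℂ} (hz : z ∈ bookC13) : AccPt z (𝓟 bookRoots) := by
  have hsub : {x : ℂ | ‖x + 2‖ = 1 ∧ ‖x + 1‖ ^ 2 < ‖x‖} ⊆ derivedSet bookRoots :=
    fun x hx => accPt_of_mem_C13_strict hx.1 hx.2
  exact closure_minimal hsub (isClosed_derivedSet _) (bookC13_subset_closure hz)

theorem accPt_of_mem_bookC12 {z : ℂ} (hz : z ∈ bookC12) : AccPt z (𝓟 bookRoots) := by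
  obtain ⟨h, hle⟩ := hz
  rcases hle.lt_or_eq with hlt | heq
  · exact accPt_of_mem_C12_strict h hlt
  · have hz0 : ‖z‖ ≠ 0 := by
      intro h0
      rw [norm_eq_zero] at h0
      subst h0
      norm_num at h
    rw [← heq, norm_mul] at h
    exact accPt_of_mem_bookC13 ⟨mul_left_cancel₀ hz0 (h.trans (mul_one _).symm), heq.ge⟩

theorem accPt_of_mem_bookC23 {z : ℂ} (hz : z ∈ bookC23) : AccPt z (𝓟 bookRoots) := by
  obtain ⟨h, hle⟩ := hz
  rcases hle.lt_or_eq with hlt | heq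
  · exact accPt_of_mem_C23_strict h hlt
  · exact accPt_of_mem_bookC13 ⟨heq, h.le⟩

/-- Off the exceptional set one term dominates strictly, with a nonzero coefficient. -/
theorem notMem_bookRootLimits {z : ℂ} (h0 : z ≠ 0) (h1 : z ≠ -1 / 2) (h12 : z ∉ bookC12)
    (h13 : z ∉ bookC13) (h23 : z ∉ bookC23) : z ∉ bookRootLimits := by
  have hz : 0 < ‖z‖ := norm_pos_iff.2 h0
  have hβ : 2 * z + 1 ≠ 0 := fun h => h1 (by linear_combination h / 2)
  -- Off each curve, a tie between two moduli forces the third to be strictly larger; so there is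
  -- always a unique maximum.
  have n12 : ‖z * (z + 2)‖ = ‖z + 1‖ ^ 2 → ‖z + 1‖ ^ 2 < ‖z‖ := fun h => by
    by_contra! hle
    exact h12 ⟨h, hle⟩
  have n13 : ‖z * (z + 2)‖ = ‖z‖ → ‖z‖ < ‖z + 1‖ ^ 2 := fun h => by
    by_contra! hle
    rw [norm_mul] at h
    exact h13 ⟨mul_left_cancel₀ hz.ne' (h.trans (mul_one _).symm), hle⟩
  have n23 : ‖z + 1‖ ^ 2 = ‖z‖ → ‖z‖ < ‖z * (z + 2)‖ := fun h => by
    by_contra! hle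
    rw [norm_mul] at hle
    exact h23 ⟨h, le_of_mul_le_mul_left (hle.trans (mul_one _).ge) hz⟩
  have key : ∀ᶠ x : ℕ × ℂ in atTop ×ˢ 𝓝 z, x.2 ^ 2 * ((x.2 + 1) ^ 2) ^ x.1 +
      (2 * x.2 + 1) * (x.2 * (x.2 + 2)) ^ x.1 + -2 * x.2 ^ x.1 ≠ 0 := by
    rw [← norm_pow] at n12 n13 n23
    rcases lt_trichotomy ‖z * (z + 2)‖ ‖(z + 1) ^ 2‖ with hA | hA | hA
    · rcases lt_trichotomy ‖z‖ ‖(z + 1) ^ 2‖ with hB | hB | hB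
      · refine (eventually_ne_zero_of_dominant (p := fun x => x * (x + 2))
          (q := fun x => (x + 1) ^ 2) (r := fun x => x) (α := fun x => 2 * x + 1)
          (β := fun x => x ^ 2) (γ := fun _ => -2) (z := z) (by fun_prop) (by fun_prop)
          (by fun_prop) (by fun_prop) (by fun_prop) (by fun_prop) hA hB
          (pow_ne_zero 2 h0)).mono fun x hx => ?_
        convert hx using 1
        ring
      · linarith [n23 hB.symm]
      · refine (eventually_ne_zero_of_dominant (p := fun x => x * (x + 2))
          (q := fun x => x) (r := fun x => (x + 1) ^ 2) (α := fun x => 2 * x + 1)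
          (β := fun _ => -2) (γ := fun x => x ^ 2) (z := z) (by fun_prop) (by fun_prop)
          (by fun_prop) (by fun_prop) (by fun_prop) (by fun_prop) (hA.trans hB) hB
          (by norm_num)).mono fun x hx => ?_
        convert hx using 1
        ring
    · have hB := n12 hA
      refine (eventually_ne_zero_of_dominant (p := fun x => x * (x + 2))
        (q := fun x => x) (r := fun x => (x + 1) ^ 2) (α := fun x => 2 * x + 1)
        (β := fun _ => -2) (γ := fun x => x ^ 2) (z := z) (by fun_prop) (by fun_prop)
        (by fun_prop) (by fun_prop) (by fun_prop) (by fun_prop) (hA.trans_lt hB) hB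
        (by norm_num)).mono fun x hx => ?_
      convert hx using 1
      ring
    · rcases lt_trichotomy ‖z‖ ‖z * (z + 2)‖ with hB | hB | hB
      · exact eventually_ne_zero_of_dominant (p := fun x => (x + 1) ^ 2)
          (q := fun x => x * (x + 2)) (r := fun x => x) (α := fun x => x ^ 2)
          (β := fun x => 2 * x + 1) (γ := fun _ => -2) (z := z) (by fun_prop) (by fun_prop)
          (by fun_prop) (by fun_prop) (by fun_prop) (by fun_prop) hA hB hβ
      · linarith [n13 hB.symm]
      · refine (eventually_ne_zero_of_dominant (p := fun x => x * (x + 2))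
          (q := fun x => x) (r := fun x => (x + 1) ^ 2) (α := fun x => 2 * x + 1)
          (β := fun _ => -2) (γ := fun x => x ^ 2) (z := z) (by fun_prop) (by fun_prop)
          (by fun_prop) (by fun_prop) (by fun_prop) (by fun_prop) hB (hA.trans hB)
          (by norm_num)).mono fun x hx => ?_
        convert hx using 1
        ring
  refine not_isLimitOfRoots (fun n hn => dominationPolynomial_bookGraph_ne_zero hn) ?_
  filter_upwards [key, tendsto_fst.eventually (eventually_ge_atTop 1)] with x hx hx1
  rwa [aeval_dominationPolynomial_bookGraph hx1]

theorem bookRootLimits_eq :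
    bookRootLimits = {0, -1 / 2} ∪ bookC12 ∪ bookC13 ∪ bookC23 := by
  ext z
  constructor
  · intro hz
    by_contra hcon
    simp only [Set.mem_union, Set.mem_insert_iff, Set.mem_singleton_iff, not_or] at hcon
    obtain ⟨⟨⟨⟨h0, h1⟩, h12⟩, h13⟩, h23⟩ := hcon
    exact notMem_bookRootLimits h0 h1 h12 h13 h23 hz
  · rintro ((((rfl | rfl) | h) | h) | h)
    · exact zero_mem_bookRootLimits
    · exact isLimitOfRoots_of_accPt accPt_neg_half
    · exact isLimitOfRoots_of_accPt (accPt_of_mem_bookC12 h)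
    · exact isLimitOfRoots_of_accPt (accPt_of_mem_bookC13 h)
    · exact isLimitOfRoots_of_accPt (accPt_of_mem_bookC23 h)

theorem theorem5p1 :
    bookRootLimits = {0, -1 / 2} ∪ bookC12 ∪ bookC13 ∪ bookC23 ∧
    bookC12 = {x : ℂ | (x.re + 1) ^ 2 - x.im ^ 2 = 1 / 2 ∧ ‖x + 1‖ ^ 2 ≥ ‖x‖} ∧
    (bookC13 = {x : ℂ | (x.re + 2) ^ 2 + x.im ^ 2 = 1 ∧ ‖x‖ ≥ ‖x + 1‖ ^ 2} ∧ IsArc bookC13) ∧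
    (bookC23 = {x : ℂ | ((x.re + 1) ^ 2 + x.im ^ 2) ^ 2 = x.re ^ 2 + x.im ^ 2 ∧ ‖x + 2‖ ≤ 1} ∧
      IsArc bookC23) :=
  ⟨bookRootLimits_eq, bookC12_eq, ⟨bookC13_eq, isArc_bookC13⟩, ⟨bookC23_eq, isArc_bookC23⟩⟩
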